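/- Let $n\ge 1$, let $\lambda(1)\ge\dots\ge\lambda(n)>0$, let $\bar\alpha>0$, and let $\{h_\alpha(k):\alpha\in(0,\bar\alpha],\ k=1,\dots,n\}$ be an ordered smoother: for each $\alpha$, $k\mapsto h_\alpha(k)\in[0,1]$ is monotone (non-decreasing or non-increasing), and if $h_{\alpha_1}(k')<h_{\alpha_2}(k')$ for some $k'$, then $h_{\alpha_1}(k)\le h_{\alpha_2}(k)$ for all $k$. Let $\xi(1),\dots,\xi(n)$ be i.i.d. $\mathcal N(0,1)$ and put $$\eta_\alpha=\sum_{k=1}^n\lambda^{-1}(k)[2h_\alpha(k)-h_\alpha^2(k)](\xi^2(k)-1),\qquad D(\alpha)=\Bigl\{2\sum_{k=1}^n\lambda^{-2}(k)[2h_\alpha(k)-h^2_\alpha(k)]^2\Bigr\}^{1/2}.$$ Assume that $0<D(\bar\alpha)\le D(\alpha)$ for all $\alpha\in(0,\bar\alpha]$ (the second inequality holds, for instance, when $h_\alpha(k)$ is non-increasing in $\alpha$). Put $$\rho_\alpha(k)=\sqrt2\,D^{-1}(\alpha)\lambda^{-1}(k)[2h_\alpha(k)-h_\alpha^2(k)],\qquad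 F(x)=\tfrac12\log(1-2x)+x+\frac{2x^2}{1-2x},$$ let $\mu_\alpha$ be the (unique) number $\mu\ge0$ with $2\mu\rho_\alpha(k)<1$ for all $k$ and $$\sum_{k=1}^nF[\mu\rho_\alpha(k)]=\log\frac{D(\alpha)}{D(\bar\alpha)},$$ and let $$Q^\circ(\alpha)=2D(\alpha)\mu_\alpha\sum_{k=1}^n\frac{\rho_\alpha^2(k)}{1-2\mu_\alpha\rho_\alpha(k)}.$$ Then for every $M$ there is a constant $C>0$ depending only on $M$ (not on $n$, $\lambda$, $\bar\alpha$, the family $h$ or the probability space) such that for all $0\le r<\gamma\le M$ $$\mathbf E\sup_{\alpha\in(0,\bar\alpha]}\bigl[\eta_\alpha-(1+\gamma)Q^\circ(\alpha)\bigr]_+^{1+r}\le\frac{C\,D(\bar\alpha)^{1+r}}{(\gamma-r)^3}.$$ -/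

import Mathlib

open MeasureTheory ProbabilityTheory Set

noncomputable section

namespace SpectralReg

/-- A family `h α`, `α ∈ (0, αbar]`, of sequences indexed by `1, …, n` is an ordered smoother:
every member is `[0,1]`-valued and monotone (in either direction) in the index, and two members
never cross. -/
structure IsOrderedSmoother {n : ℕ} (αbar : ℝ) (h : ℝ → Fin n → ℝ) : Prop where
  mem_Icc : ∀ α ∈ Ioc 0 αbar, ∀ k, h α k ∈ Icc (0 : ℝ) 1
  monotone : ∀ α ∈ Ioc 0 αbar, Monotone (h α) ∨ Antitone (h α)
  ordered : ∀ α₁ ∈ Ioc 0 αbar, ∀ α₂ ∈ Ioc 0 αbar,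
    (∃ k', h α₁ k' < h α₂ k') → ∀ k, h α₁ k ≤ h α₂ k

/-- The weight `λ⁻¹(k) [2 h_α(k) - h_α(k)²]`. -/
def weight {n : ℕ} (lam : Fin n → ℝ) (h : ℝ → Fin n → ℝ) (α : ℝ) (k : Fin n) : ℝ :=
  (lam k)⁻¹ * (2 * h α k - h α k ^ 2)

/-- The process `η_α = ∑ₖ λ⁻¹(k) [2 h_α(k) - h_α(k)²] (x(k)² - 1)`, as a function of the noise
vector `x`. -/
def eta {n : ℕ} (lam : Fin n → ℝ) (h : ℝ → Fin n → ℝ) (α : ℝ) (x : Fin n → ℝ) : ℝ :=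
  ∑ k, weight lam h α k * (x k ^ 2 - 1)

/-- `D(α) = {2 ∑ₖ λ⁻²(k) [2 h_α(k) - h_α(k)²]²}^{1/2}`. -/
def D {n : ℕ} (lam : Fin n → ℝ) (h : ℝ → Fin n → ℝ) (α : ℝ) : ℝ :=
  Real.sqrt (2 * ∑ k, weight lam h α k ^ 2)

/-- `ρ_α(k) = √2 D(α)⁻¹ λ⁻¹(k) [2 h_α(k) - h_α(k)²]`. -/
def rho {n : ℕ} (lam : Fin n → ℝ) (h : ℝ → Fin n → ℝ) (α : ℝ) (k : Fin n) : ℝ :=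
  Real.sqrt 2 * (D lam h α)⁻¹ * weight lam h α k

/-- `F(x) = (1/2) log (1 - 2x) + x + 2x² / (1 - 2x)`, of interest for `x < 1/2`. -/
def F (x : ℝ) : ℝ := 1 / 2 * Real.log (1 - 2 * x) + x + 2 * x ^ 2 / (1 - 2 * x)

/-- `m` is a nonnegative root, in the domain of the function `m ↦ ∑ₖ F(m ρ_α(k))`, of the equation
`∑ₖ F(m ρ_α(k)) = log (D(α) / D(αbar))`. -/
def IsRoot {n : ℕ} (lam : Fin n → ℝ) (h : ℝ → Fin n → ℝ) (αbar α m : ℝ) : Prop :=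
  0 ≤ m ∧ (∀ k, 2 * (m * rho lam h α k) < 1) ∧
    ∑ k, F (m * rho lam h α k) = Real.log (D lam h α / D lam h αbar)

open Classical in
/-- The root `μ_α`; it exists and is unique if `0 < D(αbar) ≤ D(α)`
(see `existsUnique_isRoot` and `isRoot_mu`), and the default value `0` is not used then. -/
def mu {n : ℕ} (lam : Fin n → ℝ) (h : ℝ → Fin n → ℝ) (αbar α : ℝ) : ℝ :=
  if hm : ∃ m, IsRoot lam h αbar α m then hm.choose else 0

/-- The penalty `Q°(α) = 2 D(α) μ_α ∑ₖ ρ_α(k)² / (1 - 2 μ_α ρ_α(k))`. -/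
def Qcirc {n : ℕ} (lam : Fin n → ℝ) (h : ℝ → Fin n → ℝ) (αbar α : ℝ) : ℝ :=
  2 * D lam h α * mu lam h αbar α *
    ∑ k, rho lam h α k ^ 2 / (1 - 2 * (mu lam h αbar α * rho lam h α k))

theorem F_eq {x : ℝ} (hx : 2 * x < 1) :
    F x = 1 / 2 * (Real.log (1 - 2 * x) - 1 + (1 - 2 * x)⁻¹) := by
  have : (1 - 2 * x) ≠ 0 := by linarith
  unfold F
  field_simp
  ring

theorem F_lt_F {x y : ℝ} (hx : 0 ≤ x) (hxy : x < y) (hy : 2 * y < 1) : F x < F y := by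
  rw [F_eq hy, F_eq (by linarith)]
  have hb : 0 < 1 - 2 * y := by linarith
  have ha : 0 < 1 - 2 * x := by linarith
  set a := 1 - 2 * x with ha'
  set b := 1 - 2 * y with hb'
  have hab : b < a := by linarith
  have h1 : Real.log (a / b) < a / b - 1 :=
    Real.log_lt_sub_one_of_pos (by positivity) (by rw [Ne, div_eq_one_iff_eq hb.ne']; linarith)
  rw [Real.log_div ha.ne' hb.ne'] at h1
  have h2 : a / b - 1 ≤ b⁻¹ - a⁻¹ := by
    have : b⁻¹ - a⁻¹ - (a / b - 1) = (a - b) * (1 - a) / (a * b) := by field_simp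
    have h3 : 0 ≤ (a - b) * (1 - a) / (a * b) := by
      apply div_nonneg (mul_nonneg _ _) <;> first | positivity | linarith
    linarith
  linarith

theorem F_nonneg {x : ℝ} (hx : 2 * x < 1) : 0 ≤ F x := by
  rw [F_eq hx]
  have := Real.one_sub_inv_le_log_of_pos (show 0 < 1 - 2 * x by linarith)
  linarith

theorem F_ge {s : ℝ} (hs : 0 < s) : (s - 1) ^ 2 / 2 ≤ F ((1 - (s ^ 2)⁻¹) / 2) := by
  have h0 : 0 < (s ^ 2)⁻¹ := by positivity
  rw [F_eq (by linarith)]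
  have h1 : 1 - 2 * ((1 - (s ^ 2)⁻¹) / 2) = (s ^ 2)⁻¹ := by ring
  rw [h1, inv_inv, Real.log_inv, Real.log_pow]
  have := Real.log_le_sub_one_of_pos hs
  push_cast
  nlinarith

theorem existsUnique_isRoot {n : ℕ} {lam : Fin n → ℝ} {h : ℝ → Fin n → ℝ} {αbar α : ℝ}
    (hlam : ∀ k, 0 < lam k) (hh : ∀ k, h α k ∈ Icc (0 : ℝ) 1)
    (hD0 : 0 < D lam h αbar) (hD : D lam h αbar ≤ D lam h α) :
    ∃! m, IsRoot lam h αbar α m := by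
  have hDα : 0 < D lam h α := hD0.trans_le hD
  have hw : ∀ k, 0 ≤ weight lam h α k := fun k => by
    have := hh k
    have h1 := (hlam k).le
    exact mul_nonneg (inv_nonneg.2 h1) (by nlinarith [this.1, this.2])
  have hρ : ∀ k, 0 ≤ rho lam h α k := fun k =>
    mul_nonneg (by positivity) (hw k)
  obtain ⟨k₀, hk₀⟩ : ∃ k, weight lam h α k ≠ 0 := by
    by_contra! hc
    simp [D, hc] at hDα
  obtain ⟨K, -, hK⟩ := Finset.exists_max_image Finset.univ (rho lam h α) ⟨k₀, Finset.mem_univ _⟩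
  have hK0 : 0 < rho lam h α K := by
    refine lt_of_lt_of_le ?_ (hK k₀ (Finset.mem_univ _))
    have := (hw k₀).lt_of_ne hk₀.symm
    unfold rho
    positivity
  set y := Real.log (D lam h α / D lam h αbar)
  have hy : 0 ≤ y := Real.log_nonneg ((one_le_div hD0).2 hD)
  set f : ℝ → ℝ := fun m => ∑ k, F (m * rho lam h α k) with hf
  have hs : (0 : ℝ) < y + 2 := by linarith
  set s := y + 2 + 1 with hs'
  set x := (1 - (s ^ 2)⁻¹) / 2 with hx
  have hs1 : (s ^ 2)⁻¹ ≤ 1 := inv_le_one_of_one_le₀ (by nlinarith)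
  have hx0 : 0 ≤ x := by rw [hx]; linarith
  have hx1 : 2 * x < 1 := by
    have : 0 < (s ^ 2)⁻¹ := by positivity
    rw [hx]; linarith
  set M := x / rho lam h α K with hM
  have hM0 : 0 ≤ M := by positivity
  have hMK : M * rho lam h α K = x := by rw [hM]; field_simp
  have hdom : ∀ m ∈ Icc 0 M, ∀ k, 2 * (m * rho lam h α k) < 1 := by
    intro m hm k
    have : m * rho lam h α k ≤ M * rho lam h α K :=
      mul_le_mul hm.2 (hK k (Finset.mem_univ _)) (hρ k) hM0
    linarith
  have hcont : ContinuousOn f (Icc 0 M) := by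
    refine continuousOn_finsetSum _ fun k _ => ?_
    have hne : ∀ m ∈ Icc 0 M, 1 - 2 * (m * rho lam h α k) ≠ 0 := fun m hm => by
      have := hdom m hm k
      linarith
    unfold F
    refine ContinuousOn.add (ContinuousOn.add (ContinuousOn.mul (by fun_prop)
      (ContinuousOn.log (by fun_prop) hne)) (by fun_prop)) (ContinuousOn.div (by fun_prop)
      (by fun_prop) hne)
  have hf0 : f 0 = 0 := by simp [hf, F]
  have hfM : y ≤ f M := by
    have h1 : F (M * rho lam h α K) ≤ f M :=
      Finset.single_le_sum (f := fun k => F (M * rho lam h α k))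
        (fun k _ => F_nonneg (hdom M ⟨hM0, le_rfl⟩ k)) (Finset.mem_univ K)
    have h2 := F_ge (s := s) (by linarith)
    rw [hMK] at h1
    nlinarith
  obtain ⟨m, hm, hmy⟩ := intermediate_value_Icc hM0 hcont (show y ∈ Icc (f 0) (f M) from
    ⟨by rw [hf0]; exact hy, hfM⟩)
  refine ⟨m, ⟨hm.1, hdom m hm, hmy⟩, ?_⟩
  have key : ∀ a b, IsRoot lam h αbar α a → IsRoot lam h αbar α b → ¬ a < b := by
    rintro a b ⟨ha0, -, ha⟩ ⟨-, hb1, hb⟩ hab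
    have : ∑ k, F (a * rho lam h α k) < ∑ k, F (b * rho lam h α k) := by
      refine Finset.sum_lt_sum (fun k _ => ?_) ⟨K, Finset.mem_univ _, ?_⟩
      · rcases (hρ k).eq_or_lt with h0 | h0
        · simp [← h0]
        · exact (F_lt_F (by positivity) (mul_lt_mul_of_pos_right hab h0) (hb1 k)).le
      · exact F_lt_F (by positivity) (mul_lt_mul_of_pos_right hab hK0) (hb1 K)
    linarith
  intro m' hm'
  exact le_antisymm (not_lt.1 (key _ _ ⟨hm.1, hdom m hm, hmy⟩ hm'))
    (not_lt.1 (key _ _ hm' ⟨hm.1, hdom m hm, hmy⟩))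

theorem isRoot_mu {n : ℕ} {lam : Fin n → ℝ} {h : ℝ → Fin n → ℝ} {αbar α : ℝ}
    (hlam : ∀ k, 0 < lam k) (hh : ∀ k, h α k ∈ Icc (0 : ℝ) 1)
    (hD0 : 0 < D lam h αbar) (hD : D lam h αbar ≤ D lam h α) :
    IsRoot lam h αbar α (mu lam h αbar α) := by
  have hm : ∃ m, IsRoot lam h αbar α m := (existsUnique_isRoot hlam hh hD0 hD).exists
  rw [mu, dif_pos hm]
  exact hm.choose_spec

end SpectralReg

end

/-! Write `y = log (D α / D αbar)` and `K(μ) = ∑ₖ cgf(μ ρ_α(k))`, the log-Laplace transform of `√2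
η_α / D α`. Since `F(x) = x cgf'(x) - cgf(x)`, the equation for `μ_α` reads `μ K'(μ) - K(μ) = y`,
and `Q° = D K'(μ)`. Chernoff's bound at tilt `μ` gives `√2 η_α > Q°` probability at most `e^{-y}`.
The penalty is thus larger by `√2` than the level natural for `η_α`, and this slack drives the
proof: it pays for a Hölder inequality and still beats the factor `(D α / D αbar)^{1+r} =
e^{(1+r)y}` at an exponential rate in `y` that does not degenerate as `γ - r → 0`. The bound is
therefore uniform in `γ - r`, and `(γ - r)⁻³` only enters through `γ - r ≤ M`.

For the supremum, the parameters are cut into blocks on which `y²` varies by at most `1/10000`. In a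
block with `D`-minimal element `α₀`, Hölder separates `η_{α₀}`, handled by the exact Laplace
transform, from the increments `η_α - η_{α₀}`. Ordering makes these sub-Gaussian near the origin for
`√|D(α)² - D(β)²|`, a one-dimensional index, so bisection chaining (`lintegral_sup_exp_le`) applies.
The block bounds (`lintegral_sup_block_le`) are summable. -/

namespace SpectralReg

/-! ### Convexity and quadratic bounds for the cumulant generating function and for `F`. -/

/-- The cumulant generating function `-x - (1/2) log (1 - 2x)` of `ζ² - 1` for a standard
Gaussian `ζ`. -/
noncomputable def cgf (x : ℝ) : ℝ := -x - 1 / 2 * Real.log (1 - 2 * x)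

/-- As `2x / (1 - 2x)` is the derivative of `cgf`, this exhibits `F` as the Legendre transform of
`cgf` at the slope attained at `x`. -/
theorem F_eq_sub_cgf (x : ℝ) : F x = x * (2 * x / (1 - 2 * x)) - cgf x := by
  unfold F cgf
  ring

theorem cgf_nonneg {x : ℝ} (hx : 2 * x < 1) : 0 ≤ cgf x := by
  have := Real.log_le_sub_one_of_pos (show 0 < 1 - 2 * x by linarith)
  unfold cgf
  linarith

/-- The tangent line inequality for the convex function `cgf`. -/
theorem cgf_add_le {x y : ℝ} (hx : 2 * x < 1) (hy : 2 * y < 1) :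
    cgf y + (x - y) * (2 * y / (1 - 2 * y)) ≤ cgf x := by
  have hx' : 0 < 1 - 2 * x := by linarith
  have hy' : 0 < 1 - 2 * y := by linarith
  have h := Real.log_le_sub_one_of_pos (div_pos hx' hy')
  rw [Real.log_div hx'.ne' hy'.ne'] at h
  have h1 : (1 - 2 * x) / (1 - 2 * y) - 1 = -2 * ((x - y) / (1 - 2 * y)) := by
    field_simp
    ring
  have h2 : (x - y) * (2 * y / (1 - 2 * y)) = (x - y) / (1 - 2 * y) - (x - y) := by
    rw [← mul_div_assoc, div_sub' hy'.ne']
    ring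
  unfold cgf
  rw [h2]
  rw [h1] at h
  linarith

theorem cgf_mono {x y : ℝ} (hx : 0 ≤ x) (hxy : x ≤ y) (hy : 2 * y < 1) : cgf x ≤ cgf y := by
  have h := cgf_add_le hy (show 2 * x < 1 by linarith)
  have : 0 ≤ (y - x) * (2 * x / (1 - 2 * x)) :=
    mul_nonneg (by linarith) (div_nonneg (by linarith) (by linarith))
  linarith

/-- This is `u ≤ sinh u` at `u = -log (1 - x)`. -/
theorem neg_log_one_sub_le {x : ℝ} (hx0 : 0 ≤ x) (hx : x < 1) :
    -Real.log (1 - x) ≤ x + x ^ 2 / (2 * (1 - x)) := by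
  have hpos : 0 < 1 - x := by linarith
  have h := Real.self_le_sinh_iff.2 (Real.log_nonneg ((one_le_inv₀ hpos).2 (by linarith)))
  rw [Real.sinh_log (by positivity), inv_inv, Real.log_inv] at h
  have : x + x ^ 2 / (2 * (1 - x)) = ((1 - x)⁻¹ - (1 - x)) / 2 := by
    field_simp
    ring
  rwa [this]

theorem cgf_le {x : ℝ} (hx0 : 0 ≤ x) (hx : x ≤ 1 / 4) : cgf x ≤ 2 * x ^ 2 := by
  have h := neg_log_one_sub_le (x := 2 * x) (by linarith) (by linarith)
  have h2 : (2 * x) ^ 2 / (2 * (1 - 2 * x)) ≤ 4 * x ^ 2 := by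
    rw [div_le_iff₀ (by linarith)]
    nlinarith [mul_nonneg (sq_nonneg x) (show 0 ≤ 1 - 4 * x by linarith)]
  unfold cgf
  linarith

theorem sq_le_F {x : ℝ} (hx0 : 0 ≤ x) (hx : 2 * x < 1) : x ^ 2 ≤ F x := by
  have h := neg_log_one_sub_le (x := 2 * x) (by linarith) hx
  have hpos : 0 < 1 - 2 * x := by linarith
  have h2 : (2 * x) ^ 2 / (2 * (1 - 2 * x)) = 2 * x ^ 2 / (1 - 2 * x) := by
    field_simp
  have h3 : 2 * x ^ 2 ≤ 2 * x ^ 2 / (1 - 2 * x) := by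
    rw [le_div_iff₀ hpos]
    nlinarith [sq_nonneg x]
  unfold F
  rw [h2] at h
  linarith

theorem F_le {x : ℝ} (hx : x ≤ 1 / 4) : F x ≤ 4 * x ^ 2 := by
  have hpos : 0 < 1 - 2 * x := by linarith
  have h := Real.log_le_sub_one_of_pos hpos
  have h2 : 2 * x ^ 2 / (1 - 2 * x) ≤ 4 * x ^ 2 := by
    rw [div_le_iff₀ hpos]
    nlinarith [sq_nonneg x]
  unfold F
  linarith

/-! ### Laplace transform of Gaussian quadratic forms. -/

theorem exp_mul_gaussianPDFReal_eq (θ x : ℝ) :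
    Real.exp (θ * (x ^ 2 - 1)) * gaussianPDFReal 0 1 x =
      Real.exp (-θ) * (√(2 * Real.pi))⁻¹ * Real.exp (-((1 - 2 * θ) / 2) * x ^ 2) := by
  rw [gaussianPDFReal]
  have : Real.exp (θ * (x ^ 2 - 1)) * Real.exp (-x ^ 2 / 2) =
      Real.exp (-θ) * Real.exp (-((1 - 2 * θ) / 2) * x ^ 2) := by
    rw [← Real.exp_add, ← Real.exp_add]
    ring_nf
  simp only [NNReal.coe_one, mul_one, sub_zero]
  linear_combination (√(2 * Real.pi))⁻¹ * this

theorem integrable_exp_mul_sq_sub_one {θ : ℝ} (hθ : 2 * θ < 1) :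
    Integrable (fun x => Real.exp (θ * (x ^ 2 - 1))) (gaussianReal 0 1) := by
  rw [gaussianReal_of_var_ne_zero 0 one_ne_zero, gaussianPDF_def,
    integrable_withDensity_iff (by fun_prop) (by simp)]
  simp only [ENNReal.toReal_ofReal (gaussianPDFReal_nonneg _ _ _), exp_mul_gaussianPDFReal_eq]
  exact (integrable_exp_neg_mul_sq (by linarith)).const_mul _

theorem integral_exp_mul_sq_sub_one {θ : ℝ} (hθ : 2 * θ < 1) :
    ∫ x, Real.exp (θ * (x ^ 2 - 1)) ∂gaussianReal 0 1 = Real.exp (cgf θ) := by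
  have hpos : 0 < 1 - 2 * θ := by linarith
  rw [integral_gaussianReal_eq_integral_smul one_ne_zero]
  simp_rw [smul_eq_mul, mul_comm (gaussianPDFReal 0 1 _), exp_mul_gaussianPDFReal_eq]
  rw [integral_const_mul, integral_gaussian, cgf, sub_eq_add_neg (-θ), Real.exp_add, mul_assoc]
  congr 1
  have h : Real.pi / ((1 - 2 * θ) / 2) = (2 * Real.pi) * (1 - 2 * θ)⁻¹ := by
    field_simp
  rw [h, Real.sqrt_mul (show 0 ≤ 2 * Real.pi by positivity) (1 - 2 * θ)⁻¹, ← mul_assoc, inv_mul_cancel₀ (by positivity), one_mul,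
    Real.sqrt_eq_rpow, Real.rpow_def_of_pos (by positivity), Real.log_inv]
  congr 1
  ring

/-- The Laplace transform of a weighted centred chi-square variable. -/
theorem lintegral_exp_sum {n : ℕ} {θ : Fin n → ℝ} (hθ : ∀ k, 2 * θ k < 1) :
    ∫⁻ x, ENNReal.ofReal (Real.exp (∑ k, θ k * (x k ^ 2 - 1)))
        ∂Measure.pi (fun _ : Fin n => gaussianReal 0 1) =
      ENNReal.ofReal (Real.exp (∑ k, cgf (θ k))) := by
  simp_rw [Real.exp_sum]
  rw [← ofReal_integral_eq_lintegral_ofReal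
    (Integrable.fintype_prod fun k => integrable_exp_mul_sq_sub_one (hθ k))
    (ae_of_all _ fun x => Finset.prod_nonneg fun k _ => (Real.exp_pos _).le),
    integral_fintype_prod_eq_prod (fun k (y : ℝ) => Real.exp (θ k * (y ^ 2 - 1)))]
  simp_rw [integral_exp_mul_sq_sub_one (hθ _)]

end SpectralReg

/-! ### Chaining over a one-dimensional index. -/

theorem lintegral_mul_le_rpow {Ω : Type*} [MeasurableSpace Ω] (P : Measure Ω) {p q : ℝ}
    (hpq : p.HolderConjugate q) {f g : Ω → ENNReal} (hf : Measurable f) (hg : Measurable g) :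
    ∫⁻ ω, f ω * g ω ∂P ≤ (∫⁻ ω, f ω ^ p ∂P) ^ p⁻¹ * (∫⁻ ω, g ω ^ q ∂P) ^ q⁻¹ := by
  simpa using ENNReal.lintegral_mul_le_Lp_mul_Lq P hpq hf.aemeasurable hg.aemeasurable

theorem ofReal_exp_rpow (x p : ℝ) :
    ENNReal.ofReal (Real.exp x) ^ p = ENNReal.ofReal (Real.exp (p * x)) := by
  rw [ENNReal.ofReal_rpow_of_pos (Real.exp_pos _), ← Real.exp_mul, mul_comm]

theorem measurable_finset_sup {ι Ω : Type*} [MeasurableSpace Ω] (B : Finset ι)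
    {f : ι → Ω → ENNReal} (hf : ∀ i, Measurable (f i)) :
    Measurable fun ω => B.sup fun i => f i ω := by
  simp_rw [Finset.sup_eq_iSup]
  exact Measurable.biSup _ B.countable_toSet fun i _ => hf i

theorem finset_sup_rpow {ι : Type*} (B : Finset ι) (f : ι → ENNReal) {p : ℝ} (hp : 0 < p) :
    (B.sup f) ^ p = B.sup fun i => f i ^ p :=
  Finset.apply_sup_eq_sup_comp (fun x : ENNReal => x ^ p)
    (fun _ _ => (ENNReal.monotone_rpow_of_nonneg hp.le).map_sup _ _)
    (by simp [hp])

/-- The exponent `√2` suits bisection: raising to it replaces `v` by `√2 v`, so `v²` doubles exactly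
when the interval length halves. -/
theorem holderConjugate_sqrt_two : (2 + √2).HolderConjugate √2 := by
  have h2 : √2 * √2 = 2 := Real.mul_self_sqrt (by norm_num)
  have h0 : 0 < √2 := by positivity
  rw [Real.holderConjugate_iff]
  refine ⟨by linarith, ?_⟩
  field_simp
  nlinarith

/-- The constant 24 closes the chaining induction. After cancelling, the claim is `3 · 2^(1+√2) ≤
24`, true because `√2 ≤ 2`. -/
theorem chaining_const :
    (3 : ENNReal) ^ (2 + √2)⁻¹ * (2 * 24) ^ (√2)⁻¹ ≤ 24 := by
  have h2 : √2 * √2 = 2 := Real.mul_self_sqrt (by norm_num)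
  have h0 : 0 < √2 := by positivity
  have hc := holderConjugate_sqrt_two.inv_add_inv_eq_one
  have h1 : (√2)⁻¹ ≤ 3 * (2 + √2)⁻¹ := by
    rw [← div_eq_mul_inv, inv_le_comm₀ (by positivity) (by positivity), inv_div, div_le_iff₀ (by norm_num)]
    nlinarith [Real.lt_sqrt (x := 1) (y := 2) (by norm_num)]
  calc (3 : ENNReal) ^ (2 + √2)⁻¹ * (2 * 24) ^ (√2)⁻¹
      = 3 ^ (2 + √2)⁻¹ * (2 ^ (√2)⁻¹ * 24 ^ (√2)⁻¹) := by
        rw [ENNReal.mul_rpow_of_nonneg _ _ (by positivity)]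
    _ ≤ 3 ^ (2 + √2)⁻¹ * (2 ^ (3 * (2 + √2)⁻¹) * 24 ^ (√2)⁻¹) := by
        gcongr
        norm_num
    _ = (3 * 2 ^ (3 : ℝ)) ^ (2 + √2)⁻¹ * 24 ^ (√2)⁻¹ := by
        rw [ENNReal.mul_rpow_of_nonneg _ _ (by positivity), ← ENNReal.rpow_mul, mul_assoc]
    _ = 24 := by
        rw [show (3 : ENNReal) * 2 ^ (3 : ℝ) = 24 by
          rw [show (3 : ℝ) = ((3 : ℕ) : ℝ) by norm_num, ENNReal.rpow_natCast]; norm_num,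
          ← ENNReal.rpow_add _ _ (by norm_num) (by norm_num), hc, ENNReal.rpow_one]

/-- A chaining bound: if the increments of a process over a finite index set are sub-Gaussian near
the origin for the pseudometric `√|t i - t j|`, then its one-sided supremum has a bounded
exponential moment. -/
theorem lintegral_sup_exp_le {ι Ω : Type*} [MeasurableSpace Ω] (P : Measure Ω)
    [IsProbabilityMeasure P] (X : ι → Ω → ℝ) (hX : ∀ i, Measurable (X i)) (t : ι → ℝ)
    (B : Finset ι)
    (hinc : ∀ i ∈ B, ∀ j ∈ B, t i ≤ t j → ∀ v : ℝ, 0 ≤ v → v ^ 2 * (t j - t i) ≤ 1 / 8 →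
      ∫⁻ ω, ENNReal.ofReal (Real.exp (v * (X j ω - X i ω))) ∂P
        ≤ ENNReal.ofReal (Real.exp (v ^ 2 * (t j - t i))))
    (heq : ∀ i ∈ B, ∀ j ∈ B, t i = t j → X i = X j) :
    ∀ i₀ ∈ B, (∀ j ∈ B, t i₀ ≤ t j) → ∀ v : ℝ, 0 ≤ v →
      (∀ j ∈ B, v ^ 2 * (t j - t i₀) ≤ 1 / 100) →
      ∫⁻ ω, B.sup (fun j => ENNReal.ofReal (Real.exp (v * (X j ω - X i₀ ω)))) ∂P ≤ 24 := by
  classical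
  induction B using Finset.strongInduction with
  | H B ih =>
  intro i₀ hi₀ hmin v hv hsmall
  have hmeas : ∀ (A : Finset ι) (v : ℝ) (i : ι), Measurable
      fun ω => A.sup (fun j => ENNReal.ofReal (Real.exp (v * (X j ω - X i ω)))) := by
    intro A v i
    refine measurable_finset_sup A fun j => ?_
    have := hX i
    have := hX j
    fun_prop
  obtain ⟨i₁, hi₁, hmax⟩ := Finset.exists_max_image B t ⟨i₀, hi₀⟩
  -- If all `t j` coincide, bisection would not shrink `B`, but the increments vanish and the
  -- supremum is at most 1.
  rcases (hmin i₁ hi₁).eq_or_lt with hT | hT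
  · have hall : ∀ j ∈ B, X j = X i₀ := fun j hj =>
      (heq _ hi₀ _ hj (le_antisymm (hmin j hj) (hT ▸ hmax j hj))).symm
    calc _ ≤ ∫⁻ ω, 1 ∂P := by
          refine lintegral_mono fun ω => Finset.sup_le fun j hj => ?_
          simp [hall j hj]
      _ ≤ 24 := by simp
  -- Bisect at the midpoint. The left half keeps the base point `i₀`; the right half is rebased at
  -- its leftmost point `p`, at the cost of the link `X p - X i₀`.
  set m := (t i₀ + t i₁) / 2 with hm
  set BL := B.filter (fun j => t j ≤ m) with hBL
  set BR := B.filter (fun j => m < t j) with hBR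
  have hsub : BL ⊆ B := Finset.filter_subset _ _
  have hsubR : BR ⊆ B := Finset.filter_subset _ _
  have h0L : i₀ ∈ BL := by rw [hBL, Finset.mem_filter]; exact ⟨hi₀, by linarith⟩
  have h1R : i₁ ∈ BR := by rw [hBR, Finset.mem_filter]; exact ⟨hi₁, by linarith⟩
  have hLss : BL ⊂ B := ⟨hsub, fun h => by
    have := (Finset.mem_filter.1 (h hi₁)).2; linarith⟩
  have hRss : BR ⊂ B := ⟨hsubR, fun h => by
    have := (Finset.mem_filter.1 (h hi₀)).2; linarith⟩
  obtain ⟨p, hpR, hpmin⟩ := Finset.exists_min_image BR t ⟨i₁, h1R⟩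
  have hp : p ∈ B := hsubR hpR
  have hmp : m < t p := (Finset.mem_filter.1 hpR).2
  have hs2 : √2 ^ 2 = 2 := Real.sq_sqrt (by norm_num)
  have hs0 : 0 < √2 := by positivity
  have hs1 : √2 ≤ 1.42 := by rw [Real.sqrt_le_left (by norm_num)]; norm_num
  have hscale := hsmall i₁ hi₁
  have hL := ih BL hLss (fun i hi j hj => hinc i (hsub hi) j (hsub hj))
    (fun i hi j hj => heq i (hsub hi) j (hsub hj)) i₀ h0L (fun j hj => hmin j (hsub hj))
    (√2 * v) (by positivity) (fun j hj => by
      have := (Finset.mem_filter.1 hj).2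
      rw [mul_pow, hs2]
      nlinarith [mul_le_mul_of_nonneg_left (show 2 * (t j - t i₀) ≤ t i₁ - t i₀ by linarith)
        (sq_nonneg v)])
  have hR := ih BR hRss (fun i hi j hj => hinc i (hsubR hi) j (hsubR hj))
    (fun i hi j hj => heq i (hsubR hi) j (hsubR hj)) p hpR hpmin
    (√2 * v) (by positivity) (fun j hj => by
      have := hmax j (hsubR hj)
      rw [mul_pow, hs2]
      nlinarith [mul_le_mul_of_nonneg_left (show 2 * (t j - t p) ≤ t i₁ - t i₀ by linarith)
        (sq_nonneg v)])
  have hY : ∫⁻ ω, (max 1 (ENNReal.ofReal (Real.exp (v * (X p ω - X i₀ ω))))) ^ (2 + √2) ∂P ≤ 3 := by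
    -- The link is raised to the power `2 + √2`, and `(2 + √2)² ≤ 12` turns the scale `1/100` into
    -- at most `1/8`, where the increment hypothesis holds.
    have hq : ((2 + √2) * v) ^ 2 * (t p - t i₀) ≤ 1 / 8 := by
      have h1 : (2 + √2) ^ 2 ≤ 12 := by nlinarith
      have h2 := hsmall p hp
      have h3 : 0 ≤ v ^ 2 * (t p - t i₀) := mul_nonneg (sq_nonneg v) (by linarith [hmin p hp])
      rw [mul_pow, mul_assoc]
      nlinarith
    have hb := hinc i₀ hi₀ p hp (hmin p hp) ((2 + √2) * v) (by positivity) hq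
    have he : Real.exp (((2 + √2) * v) ^ 2 * (t p - t i₀)) ≤ 2 :=
      calc _ ≤ Real.exp (1 / 8) := Real.exp_le_exp.2 hq
        _ ≤ 2 := by
          have := Real.exp_bound' (x := 1 / 8) (by norm_num) (by norm_num) (n := 2) (by norm_num)
          norm_num [Finset.sum_range_succ] at this ⊢
          linarith
    calc _ ≤ ∫⁻ ω, (1 + ENNReal.ofReal (Real.exp (((2 + √2) * v) * (X p ω - X i₀ ω)))) ∂P := by
          refine lintegral_mono fun ω => ?_
          rw [(ENNReal.monotone_rpow_of_nonneg (by positivity)).map_max, ENNReal.one_rpow,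
            ofReal_exp_rpow, ← mul_assoc]
          exact max_le le_self_add le_add_self
      _ = 1 + ∫⁻ ω, ENNReal.ofReal (Real.exp (((2 + √2) * v) * (X p ω - X i₀ ω))) ∂P := by
          rw [lintegral_add_left measurable_const]; simp
      _ ≤ 1 + ENNReal.ofReal 2 := by gcongr; exact hb.trans (ENNReal.ofReal_le_ofReal he)
      _ = 3 := by norm_num
  set S := fun ω => max (BL.sup (fun j => ENNReal.ofReal (Real.exp (v * (X j ω - X i₀ ω)))))
    (BR.sup (fun j => ENNReal.ofReal (Real.exp (v * (X j ω - X p ω))))) with hS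
  have hSm : Measurable S := (hmeas BL v i₀).max (hmeas BR v p)
  have hS2 : ∫⁻ ω, S ω ^ √2 ∂P ≤ 2 * 24 := by
    calc _ ≤ ∫⁻ ω, (BL.sup (fun j => ENNReal.ofReal (Real.exp (√2 * v * (X j ω - X i₀ ω)))) +
          BR.sup (fun j => ENNReal.ofReal (Real.exp (√2 * v * (X j ω - X p ω))))) ∂P := by
          refine lintegral_mono fun ω => ?_
          simp only [hS]
          rw [(ENNReal.monotone_rpow_of_nonneg hs0.le).map_max, finset_sup_rpow _ _ hs0,
            finset_sup_rpow _ _ hs0]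
          simp_rw [ofReal_exp_rpow, ← mul_assoc]
          exact max_le le_self_add le_add_self
      _ ≤ 24 + 24 := by
          rw [lintegral_add_left (hmeas _ _ _)]
          exact add_le_add hL hR
      _ = 2 * 24 := by norm_num
  calc _ ≤ ∫⁻ ω, max 1 (ENNReal.ofReal (Real.exp (v * (X p ω - X i₀ ω)))) * S ω ∂P := by
        refine lintegral_mono fun ω => Finset.sup_le fun j hj => ?_
        by_cases hjm : t j ≤ m
        · have hjL : j ∈ BL := Finset.mem_filter.2 ⟨hj, hjm⟩
          rw [← one_mul (ENNReal.ofReal _)]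
          refine mul_le_mul' (le_max_left _ _) (le_trans ?_ (le_max_left _ _))
          exact Finset.le_sup (f := fun j => ENNReal.ofReal (Real.exp (v * (X j ω - X i₀ ω)))) hjL
        · have hjR : j ∈ BR := Finset.mem_filter.2 ⟨hj, not_le.1 hjm⟩
          rw [show v * (X j ω - X i₀ ω) = v * (X p ω - X i₀ ω) + v * (X j ω - X p ω) by ring,
            Real.exp_add, ENNReal.ofReal_mul (Real.exp_pos _).le]
          refine mul_le_mul' (le_max_right _ _) (le_trans ?_ (le_max_right _ _))
          exact Finset.le_sup (f := fun j => ENNReal.ofReal (Real.exp (v * (X j ω - X p ω)))) hjR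
    _ ≤ (3 : ENNReal) ^ (2 + √2)⁻¹ * (2 * 24) ^ (√2)⁻¹ := by
        refine (lintegral_mul_le_rpow P holderConjugate_sqrt_two ?_ hSm).trans ?_
        · have := hX p; have := hX i₀
          fun_prop
        · gcongr
    _ ≤ 24 := chaining_const

/-! ### Ordering of the weights and size of the root. -/

namespace SpectralReg

section Weights

variable {n : ℕ} {lam : Fin n → ℝ} {h : ℝ → Fin n → ℝ} {α β αbar : ℝ}

theorem weight_nonneg (hlam : ∀ k, 0 < lam k) (hh : ∀ k, h α k ∈ Icc (0 : ℝ) 1) (k : Fin n) :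
    0 ≤ weight lam h α k :=
  mul_nonneg (inv_nonneg.2 (hlam k).le) (by nlinarith [(hh k).1, (hh k).2])

theorem D_nonneg : 0 ≤ D lam h α := Real.sqrt_nonneg _

theorem D_sq : D lam h α ^ 2 = 2 * ∑ k, weight lam h α k ^ 2 :=
  Real.sq_sqrt (by positivity)

theorem weight_le_of_le (hlam : ∀ k, 0 < lam k) (hβ : ∀ k, h β k ∈ Icc (0 : ℝ) 1) {k : Fin n} (hk : h α k ≤ h β k) :
    weight lam h α k ≤ weight lam h β k := by
  refine mul_le_mul_of_nonneg_left ?_ (inv_nonneg.2 (hlam k).le)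
  nlinarith [(hβ k).2]

/-- The weights of an ordered smoother are ordered as the numbers `D α` are. -/
theorem weight_le_of_D_le (hlam : ∀ k, 0 < lam k) (hh : IsOrderedSmoother αbar h)
    (hα : α ∈ Ioc 0 αbar) (hβ : β ∈ Ioc 0 αbar) (hD : D lam h α ≤ D lam h β) (k : Fin n) :
    weight lam h α k ≤ weight lam h β k := by
  by_contra! hk
  have hIα := hh.mem_Icc α hα
  have hIβ := hh.mem_Icc β hβ
  have hlt : h β k < h α k := by
    by_contra! hle
    exact hk.not_ge (weight_le_of_le hlam hIβ hle)
  have hle := hh.ordered β hβ α hα ⟨k, hlt⟩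
  have hsum : ∑ k, weight lam h β k ^ 2 < ∑ k, weight lam h α k ^ 2 := by
    refine Finset.sum_lt_sum (fun j _ => ?_) ⟨k, Finset.mem_univ _, ?_⟩
    · exact pow_le_pow_left₀ (weight_nonneg hlam hIβ j) (weight_le_of_le hlam hIα (hle j)) 2
    · exact pow_lt_pow_left₀ hk (weight_nonneg hlam hIβ k) two_ne_zero
  have := pow_le_pow_left₀ D_nonneg hD 2
  rw [D_sq, D_sq] at this
  linarith

/-- For `0 ≤ a ≤ b` one has `(b - a)² ≤ b² - a²`; so the variance of an increment of `η` is at most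
the increment of `D²`. -/
theorem two_mul_sum_weight_sub_sq_le (hw : ∀ k, 0 ≤ weight lam h α k)
    (hle : ∀ k, weight lam h α k ≤ weight lam h β k) :
    2 * ∑ k, (weight lam h β k - weight lam h α k) ^ 2 ≤ D lam h β ^ 2 - D lam h α ^ 2 := by
  rw [D_sq, D_sq, ← mul_sub, ← Finset.sum_sub_distrib]
  gcongr with k
  nlinarith [hw k, hle k]

theorem rho_nonneg (hw : ∀ k, 0 ≤ weight lam h α k) (k : Fin n) : 0 ≤ rho lam h α k :=
  mul_nonneg (mul_nonneg (Real.sqrt_nonneg _) (inv_nonneg.2 D_nonneg)) (hw k)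

theorem sum_rho_sq (hD : 0 < D lam h α) : ∑ k, rho lam h α k ^ 2 = 1 := by
  simp_rw [rho, mul_pow, Real.sq_sqrt (show (0 : ℝ) ≤ 2 by norm_num)]
  rw [← Finset.mul_sum, mul_right_comm, ← D_sq, inv_pow]
  exact mul_inv_cancel₀ (by positivity)

theorem rho_le_one (hD : 0 < D lam h α) (k : Fin n) : rho lam h α k ≤ 1 := by
  have := Finset.single_le_sum (f := fun k => rho lam h α k ^ 2) (fun _ _ => sq_nonneg _)
    (Finset.mem_univ k)
  rw [sum_rho_sq hD] at this
  nlinarith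

theorem IsRoot.sq_le {m : ℝ} (hm : IsRoot lam h αbar α m) (hw : ∀ k, 0 ≤ weight lam h α k)
    (hD : 0 < D lam h α) : m ^ 2 ≤ Real.log (D lam h α / D lam h αbar) := by
  rw [← hm.2.2, ← mul_one (m ^ 2), ← sum_rho_sq hD, Finset.mul_sum]
  refine Finset.sum_le_sum fun k _ => ?_
  rw [← mul_pow]
  exact sq_le_F (mul_nonneg hm.1 (rho_nonneg hw k)) (hm.2.1 k)

/-- If `m < 1/4`, then `m ρ ≤ 1/4` for every weight, so `F(x) ≤ 4x²` and `∑ ρ² = 1` force the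
logarithm below `1/4`. -/
theorem IsRoot.one_quarter_le {m : ℝ} (hm : IsRoot lam h αbar α m)
    (hw : ∀ k, 0 ≤ weight lam h α k) (hD : 0 < D lam h α)
    (h1 : 1 ≤ Real.log (D lam h α / D lam h αbar)) : 1 / 4 ≤ m := by
  by_contra! hlt
  have : Real.log (D lam h α / D lam h αbar) ≤ 4 * m ^ 2 := by
    rw [← hm.2.2, ← mul_one (4 * m ^ 2), ← sum_rho_sq hD, Finset.mul_sum]
    refine Finset.sum_le_sum fun k _ => ?_
    refine (F_le (x := m * rho lam h α k) ?_).trans (by rw [mul_pow, mul_assoc])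
    nlinarith [rho_le_one hD k, rho_nonneg hw k, hm.1]
  nlinarith [hm.1]

/-! ### Duality and monotonicity of the penalty. -/

/-- The penalty per unit of `D α`: the derivative of the cumulant generating function. -/
theorem Qcirc_eq : Qcirc lam h αbar α = D lam h α * ∑ k, rho lam h α k *
    (2 * (mu lam h αbar α * rho lam h α k) / (1 - 2 * (mu lam h αbar α * rho lam h α k))) := by
  rw [Qcirc, mul_comm 2, mul_assoc, mul_assoc, ← mul_assoc 2, Finset.mul_sum]
  congr 1
  refine Finset.sum_congr rfl fun k _ => ?_
  ring

/-- The root equation in Legendre form, the equality case of `mul_Qcirc_le`. -/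
theorem mu_mul_Qcirc (hm : IsRoot lam h αbar α (mu lam h αbar α)) :
    mu lam h αbar α * Qcirc lam h αbar α = D lam h α *
      (Real.log (D lam h α / D lam h αbar) + ∑ k, cgf (mu lam h αbar α * rho lam h α k)) := by
  rw [← hm.2.2, ← Finset.sum_add_distrib, Qcirc_eq, mul_left_comm, Finset.mul_sum]
  congr 1
  refine Finset.sum_congr rfl fun k _ => ?_
  rw [F_eq_sub_cgf]
  ring

theorem Qcirc_nonneg (hm : IsRoot lam h αbar α (mu lam h αbar α)) : 0 ≤ Qcirc lam h αbar α :=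
  mul_nonneg (mul_nonneg (mul_nonneg zero_le_two D_nonneg) hm.1) <| Finset.sum_nonneg fun k _ =>
    div_nonneg (sq_nonneg _) (by linarith [hm.2.1 k])

/-- The Fenchel-Young inequality at the penalty. -/
theorem mul_Qcirc_le (hm : IsRoot lam h αbar α (mu lam h αbar α)) {ν : ℝ}
    (hν : ∀ k, 2 * (ν * rho lam h α k) < 1) :
    ν * Qcirc lam h αbar α ≤ D lam h α *
      (Real.log (D lam h α / D lam h αbar) + ∑ k, cgf (ν * rho lam h α k)) := by
  have h1 := mu_mul_Qcirc hm
  have h2 : (ν - mu lam h αbar α) * Qcirc lam h αbar α ≤ D lam h α *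
      (∑ k, cgf (ν * rho lam h α k) - ∑ k, cgf (mu lam h αbar α * rho lam h α k)) := by
    rw [Qcirc_eq, mul_left_comm, Finset.mul_sum, ← Finset.sum_sub_distrib]
    refine mul_le_mul_of_nonneg_left (Finset.sum_le_sum fun k _ => ?_) D_nonneg
    have := cgf_add_le (hν k) (hm.2.1 k)
    rw [← sub_mul, mul_assoc] at this
    linarith
  linarith

/-- By duality `Q°` behaves as the infimum over `ν > 0` of `D (y + K(ν)) / ν`, so it suffices to
test the problem at `α` with one good `ν`. -/
theorem Qcirc_le_Qcirc (hwα : ∀ k, 0 ≤ weight lam h α k)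
    (hw : ∀ k, weight lam h α k ≤ weight lam h β k) (hD0 : 0 < D lam h αbar)
    (hD : D lam h αbar ≤ D lam h α) (hDle : D lam h α ≤ D lam h β)
    (hα : IsRoot lam h αbar α (mu lam h αbar α)) (hβ : IsRoot lam h αbar β (mu lam h αbar β))
    (hμ : 0 < mu lam h αbar β) : Qcirc lam h αbar α ≤ Qcirc lam h αbar β := by
  have hDα : 0 < D lam h α := hD0.trans_le hD
  have hDβ : 0 < D lam h β := hDα.trans_le hDle
  -- With this `ν` the tilt `ν / D α` equals `μ_β / D β`, so `ν ρ_α ≤ μ_β ρ_β` is just the ordering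
  -- of the weights.
  set ν := mu lam h αbar β * D lam h α / D lam h β with hν
  have hνρ : ∀ k, ν * rho lam h α k ≤ mu lam h αbar β * rho lam h β k := by
    intro k
    have : ν * rho lam h α k = mu lam h αbar β * (√2 * (D lam h β)⁻¹ * weight lam h α k) := by
      rw [hν, rho]
      field_simp
    rw [this, rho]
    have := hw k
    gcongr
  have hν0 : ∀ k, 0 ≤ ν * rho lam h α k := fun k =>
    mul_nonneg (by positivity) (rho_nonneg hwα k)
  have h1 := mul_Qcirc_le hα (ν := ν) fun k => by linarith [hνρ k, hβ.2.1 k]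
  have h2 : Real.log (D lam h α / D lam h αbar) + ∑ k, cgf (ν * rho lam h α k) ≤
      Real.log (D lam h β / D lam h αbar) + ∑ k, cgf (mu lam h αbar β * rho lam h β k) := by
    gcongr with k
    exact cgf_mono (hν0 k) (hνρ k) (hβ.2.1 k)
  have h3 := mu_mul_Qcirc hβ
  have h4 := h1.trans (mul_le_mul_of_nonneg_left h2 hDα.le)
  have h5 : ν * Qcirc lam h αbar α = D lam h α / D lam h β * (mu lam h αbar β * Qcirc lam h αbar α) := by
    rw [hν]
    ring
  have h6 : D lam h α * (Real.log (D lam h β / D lam h αbar) +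
      ∑ k, cgf (mu lam h αbar β * rho lam h β k)) =
      D lam h α / D lam h β * (mu lam h αbar β * Qcirc lam h αbar β) := by
    rw [h3]
    field_simp
  rw [h5, h6] at h4
  exact le_of_mul_le_mul_left (le_of_mul_le_mul_left h4 (by positivity)) hμ

/-! ### Exponential moments of `η` and of its increments. -/

theorem measurable_eta (α : ℝ) : Measurable (eta lam h α) := by
  unfold eta
  fun_prop

/-- The exponential moment of a Gaussian quadratic form with small weights. -/
theorem lintegral_exp_mul_sum_le {d : Fin n → ℝ} (hd : ∀ k, 0 ≤ d k) {v t : ℝ} (hv : 0 ≤ v)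
    (hdt : 2 * ∑ k, d k ^ 2 ≤ t) (hvt : v ^ 2 * t ≤ 1 / 8) :
    ∫⁻ x, ENNReal.ofReal (Real.exp (v * ∑ k, d k * (x k ^ 2 - 1)))
        ∂Measure.pi (fun _ : Fin n => gaussianReal 0 1) ≤
      ENNReal.ofReal (Real.exp (v ^ 2 * t)) := by
  have hsmall : ∀ k, v * d k ≤ 1 / 4 := by
    intro k
    have h1 := Finset.single_le_sum (f := fun k => d k ^ 2) (fun _ _ => sq_nonneg _)
      (Finset.mem_univ k)
    have h2 : v ^ 2 * (2 * d k ^ 2) ≤ v ^ 2 * t :=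
      mul_le_mul_of_nonneg_left (by linarith) (sq_nonneg v)
    have h3 : (v * d k) ^ 2 ≤ (1 / 4) ^ 2 := by nlinarith
    exact le_of_sq_le_sq h3 (by norm_num)
  simp_rw [Finset.mul_sum, ← mul_assoc]
  rw [lintegral_exp_sum fun k => by linarith [hsmall k]]
  refine ENNReal.ofReal_le_ofReal (Real.exp_le_exp.2 ?_)
  calc ∑ k, cgf (v * d k) ≤ ∑ k, v ^ 2 * (2 * d k ^ 2) :=
        Finset.sum_le_sum fun k _ =>
          (cgf_le (mul_nonneg hv (hd k)) (hsmall k)).trans_eq (by ring)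
    _ = v ^ 2 * (2 * ∑ k, d k ^ 2) := by rw [← Finset.mul_sum, ← Finset.mul_sum]
    _ ≤ v ^ 2 * t := by gcongr

theorem eta_sub_eta (x : Fin n → ℝ) : eta lam h β x - eta lam h α x =
    ∑ k, (weight lam h β k - weight lam h α k) * (x k ^ 2 - 1) := by
  simp_rw [eta, ← Finset.sum_sub_distrib, sub_mul]

/-- The exponential moment of the supremum of the increments of `η` over a finite set. -/
theorem lintegral_sup_exp_eta_le (hlam : ∀ k, 0 < lam k) (hh : IsOrderedSmoother αbar h)
    {B : Finset ℝ} (hB : ∀ α ∈ B, α ∈ Ioc 0 αbar) {α₀ : ℝ} (h0 : α₀ ∈ B)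
    (hmin : ∀ α ∈ B, D lam h α₀ ≤ D lam h α) {v : ℝ} (hv : 0 ≤ v)
    (hsmall : ∀ α ∈ B, v ^ 2 * (D lam h α ^ 2 - D lam h α₀ ^ 2) ≤ 1 / 100) :
    ∫⁻ x, B.sup (fun α => ENNReal.ofReal (Real.exp (v * (eta lam h α x - eta lam h α₀ x))))
      ∂Measure.pi (fun _ : Fin n => gaussianReal 0 1) ≤ 24 := by
  have hw : ∀ α ∈ B, ∀ k, 0 ≤ weight lam h α k := fun α hα =>
    weight_nonneg hlam (hh.mem_Icc α (hB α hα))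
  have hle : ∀ α ∈ B, ∀ β ∈ B, D lam h α ^ 2 ≤ D lam h β ^ 2 → ∀ k,
      weight lam h α k ≤ weight lam h β k := fun α hα β hβ hD =>
    weight_le_of_D_le hlam hh (hB α hα) (hB β hβ) (le_of_sq_le_sq hD D_nonneg)
  refine lintegral_sup_exp_le _ (eta lam h) measurable_eta (fun α => D lam h α ^ 2) B
    (fun α hα β hβ hD v hv hvt => ?_) (fun α hα β hβ hD => ?_) α₀ h0
    (fun α hα => pow_le_pow_left₀ D_nonneg (hmin α hα) 2) v hv hsmall
  · simp_rw [eta_sub_eta]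
    exact lintegral_exp_mul_sum_le (fun k => sub_nonneg.2 (hle α hα β hβ hD k)) hv
      (two_mul_sum_weight_sub_sq_le (hw α hα) (hle α hα β hβ hD)) hvt
  · ext x
    have : weight lam h α = weight lam h β :=
      funext fun k => le_antisymm (hle α hα β hβ hD.le k) (hle β hβ α hα hD.ge k)
    simp [eta, this]

end Weights

end SpectralReg

/-! ### Countable reduction and elementary inequalities. -/

/-- No regularity in the index is needed: the supremum is a continuous function of the image point
in a separable space, so a countable dense part of the image suffices. This settles measurability of
the supremum over `α`. -/
theorem exists_countable_biSup_eq {ι E Ω : Type*} [TopologicalSpace E]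
    [TopologicalSpace.PseudoMetrizableSpace E] [SecondCountableTopology E] (S : Set ι) (Φ : ι → E)
    {g : E → Ω → ENNReal} (hg : ∀ ω, Continuous fun e => g e ω) :
    ∃ T ⊆ S, T.Countable ∧ ∀ ω, ⨆ i ∈ S, g (Φ i) ω = ⨆ i ∈ T, g (Φ i) ω := by
  obtain ⟨t, htS, htc, hdense⟩ :=
    (TopologicalSpace.IsSeparable.of_separableSpace (Φ '' S)).exists_countable_dense_subset
  obtain ⟨T, hTS, hT⟩ := SurjOn.exists_bijOn_subset (show SurjOn Φ S t from htS)
  refine ⟨T, hTS, countable_of_injective_of_countable_image hT.injOn (hT.image_eq ▸ htc),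
    fun ω => le_antisymm (iSup₂_le fun i hi => ?_) (biSup_mono hTS)⟩
  have hclosed : IsClosed {e | g e ω ≤ ⨆ i ∈ T, g (Φ i) ω} :=
    isClosed_le (hg ω) continuous_const
  refine closure_minimal ?_ hclosed (hdense (mem_image_of_mem Φ hi))
  intro e he
  obtain ⟨j, hj, rfl⟩ := hT.surjOn he
  exact le_iSup₂ (f := fun i (_ : i ∈ T) => g (Φ i) ω) j hj

theorem lintegral_biSup_le_of_finset {ι Ω : Type*} [MeasurableSpace Ω] {P : Measure Ω} {T : Set ι}
    (hT : T.Countable) {f : ι → Ω → ENNReal} (hf : ∀ i, Measurable (f i)) {c : ENNReal}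
    (hc : ∀ A : Finset ι, ↑A ⊆ T → ∫⁻ ω, A.sup (fun i => f i ω) ∂P ≤ c) :
    ∫⁻ ω, ⨆ i ∈ T, f i ω ∂P ≤ c := by
  classical
  have := hT.to_subtype
  have h1 : ∀ ω, ⨆ i ∈ T, f i ω = ⨆ A : Finset T, A.sup fun i : T => f i ω := by
    intro ω
    rw [iSup_subtype', iSup_eq_iSup_finset]
    simp_rw [Finset.sup_eq_iSup]
  simp_rw [h1]
  rw [lintegral_iSup_directed (fun A => (measurable_finset_sup A fun i : T => hf i).aemeasurable)
    (Monotone.directed_le fun A A' h ω => Finset.sup_mono h)]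
  refine iSup_le fun A => ?_
  refine le_trans (le_of_eq ?_) (hc (A.map (Function.Embedding.subtype _)) (by simp))
  simp_rw [Finset.sup_map]
  rfl

theorem max_zero_rpow_le {a s : ℝ} (ha : 0 < a) (hs : 0 < s) (x : ℝ) :
    (max 0 x) ^ a ≤ (a / s) ^ a * Real.exp (s * x) := by
  rcases le_or_gt x 0 with hx | hx
  · rw [max_eq_left hx, Real.zero_rpow ha.ne']
    positivity
  · rw [max_eq_right hx.le]
    -- This is `u ≤ e^u` at `u = s x / a`, to be raised to the power `a`.
    have h1 : x ≤ a / s * Real.exp (s * x / a) := by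
      have := Real.add_one_le_exp (s * x / a)
      calc x = a / s * (s * x / a) := by field_simp
        _ ≤ _ := by gcongr; linarith
    calc x ^ a ≤ (a / s * Real.exp (s * x / a)) ^ a := Real.rpow_le_rpow hx.le h1 ha.le
      _ = _ := by
        rw [Real.mul_rpow (by positivity) (Real.exp_pos _).le, ← Real.exp_mul,
          div_mul_cancel₀ _ ha.ne']

theorem summable_exp_neg_sqrt : Summable fun i : ℕ => Real.exp (-(√i / 1000)) := by
  refine Summable.of_norm_bounded_eventually_nat
    (g := fun i : ℕ => 24 * 1000 ^ 4 * (1 / (i : ℝ) ^ 2))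
    ((Real.summable_one_div_nat_pow.2 one_lt_two).mul_left _) ?_
  filter_upwards [Filter.eventually_gt_atTop 0] with i hi
  have hi' : (0 : ℝ) < i := by exact_mod_cast hi
  have h := Real.pow_div_factorial_le_exp (√i / 1000) (by positivity) 4
  rw [Real.norm_eq_abs, abs_of_pos (Real.exp_pos _), Real.exp_neg]
  have h2 : √(i : ℝ) ^ 4 = (i : ℝ) ^ 2 := by
    rw [show (4 : ℕ) = 2 * 2 by norm_num, pow_mul, Real.sq_sqrt hi'.le]
  rw [div_pow, h2] at h
  refine (inv_anti₀ (by positivity) h).trans_eq ?_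
  simp [Nat.factorial]
  field_simp

/-! ### The bound on one block and the sum over blocks. -/

namespace SpectralReg

variable {n : ℕ} {lam : Fin n → ℝ} {h : ℝ → Fin n → ℝ} {αbar : ℝ}

/-- The penalized supremum over a finite set in terms of one exponential moment. -/
theorem lintegral_sup_rpow_le (hlam : ∀ k, 0 < lam k) (hh : IsOrderedSmoother αbar h)
    {B : Finset ℝ} (hB : ∀ α ∈ B, α ∈ Ioc 0 αbar) {α₀ : ℝ} (h0 : α₀ ∈ B)
    (hmin : ∀ α ∈ B, D lam h α₀ ≤ D lam h α) {q : ℝ → ℝ} {q₀ : ℝ} (hq : ∀ α ∈ B, q₀ ≤ q α)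
    {a s L : ℝ} (ha : 0 < a) (hs : 0 < s)
    (hsmall : ∀ α ∈ B, 36 * s ^ 2 * (D lam h α ^ 2 - D lam h α₀ ^ 2) ≤ 1 / 100)
    (hL : ∫⁻ x, ENNReal.ofReal (Real.exp (6 / 5 * s * eta lam h α₀ x))
      ∂Measure.pi (fun _ : Fin n => gaussianReal 0 1) ≤ ENNReal.ofReal (Real.exp L)) :
    ∫⁻ x, B.sup (fun α => ENNReal.ofReal ((max 0 (eta lam h α x - q α)) ^ a))
        ∂Measure.pi (fun _ : Fin n => gaussianReal 0 1) ≤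
      ENNReal.ofReal (24 * (a / s) ^ a * Real.exp (5 / 6 * L - s * q₀)) := by
  set P := Measure.pi (fun _ : Fin n => gaussianReal 0 1)
  have hsup := lintegral_sup_exp_eta_le hlam hh hB h0 hmin (v := 6 * s) (by positivity)
    (fun α hα => by rw [mul_pow]; exact (hsmall α hα).trans' (by norm_num))
  -- The exponent on `η_{α₀}` must be below `√2`, so that `(5/6)√2 > 1` leaves part of the slack in
  -- the penalty.
  have hpq : (6 / 5 : ℝ).HolderConjugate 6 := by
    rw [Real.holderConjugate_iff]
    norm_num
  set f : (Fin n → ℝ) → ENNReal := fun x => ENNReal.ofReal (Real.exp (s * eta lam h α₀ x))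
  set g : (Fin n → ℝ) → ENNReal := fun x =>
    B.sup fun α => ENNReal.ofReal (Real.exp (s * (eta lam h α x - eta lam h α₀ x)))
  have hη := fun α => measurable_eta (lam := lam) (h := h) α
  have hf : Measurable f := by
    have := hη α₀
    fun_prop
  have hg : Measurable g := measurable_finset_sup B fun α => by
    have := hη α₀
    have := hη α
    fun_prop
  have hfg := lintegral_mul_le_rpow P hpq hf hg
  have hf' : ∫⁻ x, f x ^ (6 / 5 : ℝ) ∂P ≤ ENNReal.ofReal (Real.exp L) := by
    simp_rw [f, ofReal_exp_rpow, ← mul_assoc]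
    exact hL
  have hg' : ∫⁻ x, g x ^ (6 : ℝ) ∂P ≤ 24 := by
    simp_rw [g, finset_sup_rpow _ _ (show (0 : ℝ) < 6 by norm_num), ofReal_exp_rpow, ← mul_assoc]
    exact hsup
  set c := ENNReal.ofReal ((a / s) ^ a * Real.exp (-(s * q₀)))
  calc _ ≤ ∫⁻ x, c * (f x * g x) ∂P := by
        refine lintegral_mono fun x => Finset.sup_le fun α hα => ?_
        have h1 : (max 0 (eta lam h α x - q α)) ^ a ≤
            (a / s) ^ a * Real.exp (-(s * q₀)) * (Real.exp (s * eta lam h α₀ x) *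
              Real.exp (s * (eta lam h α x - eta lam h α₀ x))) := by
          refine (max_zero_rpow_le ha hs _).trans ?_
          rw [mul_assoc, ← Real.exp_add, ← Real.exp_add]
          gcongr
          nlinarith [hq α hα]
        refine (ENNReal.ofReal_le_ofReal h1).trans ?_
        rw [ENNReal.ofReal_mul (by positivity), ENNReal.ofReal_mul (Real.exp_pos _).le]
        refine mul_le_mul' le_rfl (mul_le_mul' le_rfl ?_)
        exact Finset.le_sup (f := fun α =>
          ENNReal.ofReal (Real.exp (s * (eta lam h α x - eta lam h α₀ x)))) hα
    _ = c * ∫⁻ x, f x * g x ∂P := lintegral_const_mul _ (hf.mul hg)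
    _ ≤ c * (ENNReal.ofReal (Real.exp L) ^ (6 / 5 : ℝ)⁻¹ * 24 ^ (6 : ℝ)⁻¹) := by
        gcongr
        refine hfg.trans ?_
        gcongr
    _ ≤ c * (ENNReal.ofReal (Real.exp (5 / 6 * L)) * 24) := by
        rw [ofReal_exp_rpow, show (6 / 5 : ℝ)⁻¹ * L = 5 / 6 * L by norm_num]
        refine mul_le_mul' le_rfl (mul_le_mul' le_rfl ?_)
        calc (24 : ENNReal) ^ (6 : ℝ)⁻¹ ≤ 24 ^ (1 : ℝ) :=
              ENNReal.rpow_le_rpow_of_exponent_le (by norm_num) (by norm_num)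
          _ = 24 := ENNReal.rpow_one _
    _ = _ := by
        rw [show (24 : ENNReal) = ENNReal.ofReal 24 by norm_num,
          ← ENNReal.ofReal_mul (Real.exp_pos _).le, ← ENNReal.ofReal_mul (by positivity)]
        congr 1
        rw [sub_eq_add_neg, Real.exp_add]
        ring

end SpectralReg

namespace SpectralReg

variable {n : ℕ} {lam : Fin n → ℝ} {h : ℝ → Fin n → ℝ} {αbar : ℝ}

/-- The constant in the bound for a single block of the index set. -/
noncomputable def blockConst (M : ℝ) : ℝ :=
  24 * (600 * (1 + M)) ^ (1 + M) * Real.exp (M + 3)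

theorem blockConst_pos {M : ℝ} (hM : 0 ≤ M) : 0 < blockConst M := by
  unfold blockConst
  positivity

/-- Trades the scale `D α` of the block for `D αbar`, at the price `e^{(1+r)y}` that the penalty
must beat. -/
theorem div_rpow_le {M r s Dα Dbar : ℝ} (hr : 0 ≤ r) (hrM : r ≤ M) (hD : 0 < Dα) (hD0 : 0 < Dbar)
    (hs : 1 / (600 * Dα) ≤ s) :
    ((1 + r) / s) ^ (1 + r) ≤
      (600 * (1 + M)) ^ (1 + M) * Dbar ^ (1 + r) * Real.exp ((1 + r) * Real.log (Dα / Dbar)) := by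
  have hs0 : 0 < s := lt_of_lt_of_le (by positivity) hs
  have h1 : (1 + r) / s ≤ 600 * (1 + M) * Dα := by
    rw [div_le_iff₀ hs0]
    rw [div_le_iff₀ (by positivity)] at hs
    nlinarith
  have h2 : Real.exp ((1 + r) * Real.log (Dα / Dbar)) = (Dα / Dbar) ^ (1 + r) := by
    rw [Real.rpow_def_of_pos (by positivity), mul_comm]
  calc ((1 + r) / s) ^ (1 + r) ≤ (600 * (1 + M) * Dα) ^ (1 + r) :=
        Real.rpow_le_rpow (by positivity) h1 (by linarith)
    _ = (600 * (1 + M)) ^ (1 + r) * Dα ^ (1 + r) := Real.mul_rpow (by nlinarith) hD.le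
    _ ≤ (600 * (1 + M)) ^ (1 + M) * Dα ^ (1 + r) := by
        gcongr
        nlinarith
    _ = _ := by
        rw [h2, mul_assoc, ← Real.mul_rpow hD0.le (by positivity), mul_div_cancel₀ _ hD0.ne']

theorem D_sq_sub_D_sq {α β : ℝ} (hD0 : 0 < D lam h αbar) (hα : 0 < D lam h α)
    (hβ : 0 < D lam h β) :
    D lam h β ^ 2 - D lam h α ^ 2 = D lam h α ^ 2 * (Real.exp (2 *
      (Real.log (D lam h β / D lam h αbar) - Real.log (D lam h α / D lam h αbar))) - 1) := by
  rw [← Real.log_div (by positivity) (by positivity), div_div_div_cancel_right₀ hD0.ne',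
    show ∀ x : ℝ, 2 * Real.log x = Real.log (x ^ 2) by intro x; rw [Real.log_pow]; norm_num,
    Real.exp_log (by positivity)]
  field_simp

/-- The bound for the penalized supremum over a block on which `log² (D α / D αbar)` is nearly
constant. -/
theorem lintegral_sup_block_le (hlam : ∀ k, 0 < lam k) (hh : IsOrderedSmoother αbar h)
    (hD0 : 0 < D lam h αbar) (hDle : ∀ α ∈ Ioc 0 αbar, D lam h αbar ≤ D lam h α)
    {r γ M : ℝ} (hr : 0 ≤ r) (hrγ : r < γ) (hγ : γ ≤ M)
    {B : Finset ℝ} (hB : ∀ α ∈ B, α ∈ Ioc 0 αbar) {α₀ : ℝ} (h0 : α₀ ∈ B)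
    (hmin : ∀ α ∈ B, D lam h α₀ ≤ D lam h α)
    (hblock : ∀ α ∈ B, Real.log (D lam h α / D lam h αbar) ^ 2 ≤
      Real.log (D lam h α₀ / D lam h αbar) ^ 2 + 1 / 10000) :
    ∫⁻ x, B.sup (fun α => ENNReal.ofReal
        ((max 0 (eta lam h α x - (1 + γ) * Qcirc lam h αbar α)) ^ (1 + r)))
        ∂Measure.pi (fun _ : Fin n => gaussianReal 0 1) ≤
      ENNReal.ofReal (blockConst M * D lam h αbar ^ (1 + r) *
        Real.exp (-(Real.log (D lam h α₀ / D lam h αbar) / 10))) := by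
  have hI := fun α hα => hh.mem_Icc α (hB α hα)
  have hw := fun α hα => weight_nonneg hlam (hI α hα)
  have hroot : ∀ α ∈ B, IsRoot lam h αbar α (mu lam h αbar α) := fun α hα =>
    isRoot_mu hlam (hI α hα) hD0 (hDle α (hB α hα))
  have hDpos : ∀ α ∈ B, 0 < D lam h α := fun α hα => hD0.trans_le (hDle α (hB α hα))
  have hDα₀ := hDpos α₀ h0
  set y := fun α => Real.log (D lam h α / D lam h αbar) with hy
  have hy0 : 0 ≤ y α₀ := Real.log_nonneg ((one_le_div hD0).2 (hDle _ (hB _ h0)))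
  have hymin : ∀ α ∈ B, y α₀ ≤ y α := fun α hα => by
    have := hmin α hα
    simp only [hy]
    gcongr
  have hM : r ≤ M := hrγ.le.trans hγ
  change _ ≤ ENNReal.ofReal (blockConst M * D lam h αbar ^ (1 + r) * Real.exp (-(y α₀ / 10)))
  have finish : ∀ s E : ℝ, 1 / (600 * D lam h α₀) ≤ s →
      (1 + r) * y α₀ + E ≤ M + 3 - y α₀ / 10 →
      24 * ((1 + r) / s) ^ (1 + r) * Real.exp E ≤
        blockConst M * D lam h αbar ^ (1 + r) * Real.exp (-(y α₀ / 10)) := by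
    intro s E hs hE
    have h1 := div_rpow_le hr hM hDα₀ hD0 hs
    have hM0 : 0 ≤ 1 + M := by linarith
    calc 24 * ((1 + r) / s) ^ (1 + r) * Real.exp E
        ≤ 24 * ((600 * (1 + M)) ^ (1 + M) * D lam h αbar ^ (1 + r) *
            Real.exp ((1 + r) * y α₀)) * Real.exp E := by gcongr
      _ = 24 * (600 * (1 + M)) ^ (1 + M) * D lam h αbar ^ (1 + r) *
            Real.exp ((1 + r) * y α₀ + E) := by
          rw [Real.exp_add]
          ring
      _ ≤ 24 * (600 * (1 + M)) ^ (1 + M) * D lam h αbar ^ (1 + r) *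
            Real.exp (M + 3 + -(y α₀ / 10)) := by
          refine mul_le_mul_of_nonneg_left (Real.exp_le_exp.2 (by linarith)) (by positivity)
      _ = _ := by
          rw [Real.exp_add, blockConst]
          ring
  rcases le_or_gt 1 (y α₀) with hy1 | hy1
  -- Far blocks: `y ≥ 1` keeps the root away from 0, so `s` is at least of order `1 / D α₀`.
  · set m := mu lam h αbar α₀ with hm
    have hr0 := hroot α₀ h0
    have hm4 : 1 / 4 ≤ m := hr0.one_quarter_le (hw α₀ h0) hDα₀ hy1
    have hmy : m ^ 2 ≤ y α₀ := hr0.sq_le (hw α₀ h0) hDα₀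
    set L := ∑ k, cgf (m * rho lam h α₀ k) with hL
    have hL0 : 0 ≤ L := Finset.sum_nonneg fun k _ => cgf_nonneg (hr0.2.1 k)
    have h2 : √2 ^ 2 = 2 := Real.sq_sqrt (by norm_num)
    have h2' : 1.404 ≤ √2 := Real.le_sqrt_of_sq_le (by norm_num)
    -- Chosen so that `6/5 · s · η_{α₀} = ∑ₖ m ρ(k) (x(k)² - 1)`, the optimal Chernoff tilt after
    -- Hölder.
    set s := 5 / 6 * (√2 * m / D lam h α₀) with hs
    have hs0 : 0 < s := by positivity
    have hq : ∀ α ∈ B, (1 + γ) * Qcirc lam h αbar α₀ ≤ (1 + γ) * Qcirc lam h αbar α := by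
      intro α hα
      refine mul_le_mul_of_nonneg_left ?_ (by linarith)
      refine Qcirc_le_Qcirc (hw α₀ h0) (weight_le_of_D_le hlam hh (hB _ h0) (hB _ hα) (hmin α hα))
        hD0 (hDle _ (hB _ h0)) (hmin α hα) hr0 (hroot α hα) ?_
      have := (hroot α hα).one_quarter_le (hw α hα) (hDpos α hα) (hy1.trans (hymin α hα))
      linarith
    have hsQ : s * Qcirc lam h αbar α₀ = 5 / 6 * √2 * (y α₀ + L) := by
      have : s * Qcirc lam h αbar α₀ = 5 / 6 * √2 / D lam h α₀ * (m * Qcirc lam h αbar α₀) := by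
        rw [hs]
        ring
      rw [this, mu_mul_Qcirc hr0]
      field_simp
      rfl
    refine (lintegral_sup_rpow_le hlam hh hB h0 hmin hq (by linarith) hs0 (L := L) ?_ ?_).trans
      (ENNReal.ofReal_le_ofReal (finish s _ ?_ ?_))
    · intro α hα
      set δ := y α - y α₀ with hδ
      have hδ0 : 0 ≤ δ := sub_nonneg.2 (hymin α hα)
      -- The block width is set by this: the chaining scale is `50 m² (e^{2δ} - 1) ≤ 200 y δ ≤
      -- 1/100`, using `m² ≤ y`.
      have hyδ : 2 * (y α₀ * δ) ≤ 1 / 10000 := by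
        have := hblock α hα
        change y α ^ 2 ≤ y α₀ ^ 2 + 1 / 10000 at this
        nlinarith
      have hδ1 : 2 * δ ≤ 1 := by nlinarith
      have he : Real.exp (2 * δ) - 1 ≤ 4 * δ := by
        have := Real.abs_exp_sub_one_le (x := 2 * δ) (by rwa [abs_of_nonneg (by positivity)])
        rw [abs_of_nonneg (show 0 ≤ 2 * δ by positivity)] at this
        linarith [le_abs_self (Real.exp (2 * δ) - 1)]
      rw [D_sq_sub_D_sq hD0 hDα₀ (hDpos α hα)]
      change 36 * s ^ 2 * (D lam h α₀ ^ 2 * (Real.exp (2 * δ) - 1)) ≤ 1 / 100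
      have : 36 * s ^ 2 * (D lam h α₀ ^ 2 * (Real.exp (2 * δ) - 1)) =
          50 * (m ^ 2 * (Real.exp (2 * δ) - 1)) := by
        rw [hs, mul_pow, div_pow (√2 * m), mul_pow √2, h2]
        field_simp
        ring
      rw [this]
      have := mul_le_mul hmy he (sub_nonneg.2 (Real.one_le_exp (by positivity))) hy0
      nlinarith
    · have : ∀ x, 6 / 5 * s * eta lam h α₀ x =
          ∑ k, m * rho lam h α₀ k * (x k ^ 2 - 1) := by
        intro x
        rw [eta, Finset.mul_sum]
        refine Finset.sum_congr rfl fun k _ => ?_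
        rw [hs, rho]
        ring
      simp_rw [this]
      exact (lintegral_exp_sum hr0.2.1).le
    · rw [hs, one_div, mul_inv, ← mul_div_assoc, div_eq_mul_inv]
      gcongr
      nlinarith
    · rw [mul_left_comm, hsQ]
      -- Since `(5/6)√2 ≥ 1.17`, the penalty outweighs `(1 + r) y + (5/6) L` by at least `0.17 y`,
      -- using only `r ≤ γ`.
      have h3 : (1 + γ) * (1.17 * (y α₀ + L)) ≤ (1 + γ) * (5 / 6 * √2 * (y α₀ + L)) := by
        refine mul_le_mul_of_nonneg_left ?_ (by linarith)
        refine mul_le_mul_of_nonneg_right ?_ (by linarith)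
        linarith
      nlinarith
  -- Near blocks: `y < 1`, so `D α₀` is comparable to `D αbar` and the penalty is merely bounded
  -- below by 0.
  · set s := 1 / (600 * D lam h α₀) with hs
    have hs0 : 0 < s := by positivity
    have hsD : s ^ 2 * D lam h α₀ ^ 2 = 1 / 360000 := by
      rw [hs, div_pow, mul_pow]
      field_simp
      norm_num
    refine (lintegral_sup_rpow_le hlam hh hB h0 hmin (q₀ := 0) (fun α hα => ?_) (by linarith) hs0
      (L := (6 / 5 * s) ^ 2 * D lam h α₀ ^ 2) ?_ ?_).trans
      (ENNReal.ofReal_le_ofReal (finish s _ le_rfl ?_))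
    · exact mul_nonneg (by linarith) (Qcirc_nonneg (hroot α hα))
    · intro α hα
      have hyα : y α ^ 2 ≤ y α₀ ^ 2 + 1 / 10000 := hblock α hα
      have hyα1 : y α ≤ 1.5 := by nlinarith
      have hexp : Real.exp (2 * (y α - y α₀)) ≤ 27.5 :=
        calc Real.exp (2 * (y α - y α₀)) ≤ Real.exp ((3 : ℕ) * 1) :=
              Real.exp_le_exp.2 (by push_cast; linarith)
          _ = Real.exp 1 ^ 3 := Real.exp_nat_mul _ _
          _ ≤ 2.72 ^ 3 := by
              gcongr
              linarith [Real.exp_one_lt_d9]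
          _ ≤ 27.5 := by norm_num
      rw [D_sq_sub_D_sq hD0 hDα₀ (hDpos α hα), mul_assoc, ← mul_assoc (s ^ 2), hsD]
      change 36 * (1 / 360000 * (Real.exp (2 * (y α - y α₀)) - 1)) ≤ 1 / 100
      linarith
    · exact lintegral_exp_mul_sum_le (hw α₀ h0) (by positivity) D_sq.ge
        (by rw [mul_pow, mul_assoc, hsD]; norm_num)
    · rw [mul_pow, mul_assoc ((6 / 5 : ℝ) ^ 2), hsD]
      nlinarith

/-- The bound for the penalized supremum over a finite set of parameters. -/
theorem lintegral_sup_finset_le (hlam : ∀ k, 0 < lam k) (hh : IsOrderedSmoother αbar h)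
    (hD0 : 0 < D lam h αbar) (hDle : ∀ α ∈ Ioc 0 αbar, D lam h αbar ≤ D lam h α)
    {r γ M : ℝ} (hr : 0 ≤ r) (hrγ : r < γ) (hγ : γ ≤ M)
    {A : Finset ℝ} (hA : ∀ α ∈ A, α ∈ Ioc 0 αbar) :
    ∫⁻ x, A.sup (fun α => ENNReal.ofReal
        ((max 0 (eta lam h α x - (1 + γ) * Qcirc lam h αbar α)) ^ (1 + r)))
        ∂Measure.pi (fun _ : Fin n => gaussianReal 0 1) ≤
      ENNReal.ofReal (blockConst M * D lam h αbar ^ (1 + r) *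
        ∑' i : ℕ, Real.exp (-(√i / 1000))) := by
  set y := fun α => Real.log (D lam h α / D lam h αbar) with hy
  -- Blocks are spaced in `y²`; in block `i` one has `√i ≤ 100 y`, so the decay `e^{-y/10}` becomes
  -- the summable `e^{-√i/1000}`.
  set idx := fun α => ⌊10000 * y α ^ 2⌋₊ with hidx
  set f := fun α (x : Fin n → ℝ) => ENNReal.ofReal
    ((max 0 (eta lam h α x - (1 + γ) * Qcirc lam h αbar α)) ^ (1 + r)) with hf
  have hfm : ∀ α, Measurable (f α) := fun α => by
    have := measurable_eta (lam := lam) (h := h) α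
    fun_prop
  have hK := blockConst_pos (show 0 ≤ M by linarith)
  have hblock : ∀ i ∈ A.image idx,
      ∫⁻ x, (A.filter fun α => idx α = i).sup (fun α => f α x)
        ∂Measure.pi (fun _ : Fin n => gaussianReal 0 1) ≤
      ENNReal.ofReal (blockConst M * D lam h αbar ^ (1 + r) * Real.exp (-(√i / 1000))) := by
    intro i hi
    obtain ⟨β, hβ, hβi⟩ := Finset.mem_image.1 hi
    obtain ⟨α₀, h0, hmin⟩ := Finset.exists_min_image (A.filter fun α => idx α = i) (D lam h)
      ⟨β, Finset.mem_filter.2 ⟨hβ, hβi⟩⟩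
    have h0' := Finset.mem_filter.1 h0
    have hlow : (i : ℝ) ≤ 10000 * y α₀ ^ 2 := by
      rw [← h0'.2]
      exact Nat.floor_le (by positivity)
    have hy0 : 0 ≤ y α₀ := Real.log_nonneg ((one_le_div hD0).2 (hDle _ (hA _ h0'.1)))
    refine (lintegral_sup_block_le hlam hh hD0 hDle hr hrγ hγ
      (fun α hα => hA α (Finset.mem_filter.1 hα).1) h0 hmin (fun α hα => ?_)).trans ?_
    · have hup := Nat.lt_floor_add_one (10000 * y α ^ 2)
      have hαi : (⌊10000 * y α ^ 2⌋₊ : ℝ) = i := by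
        exact_mod_cast (Finset.mem_filter.1 hα).2
      rw [hαi] at hup
      change y α ^ 2 ≤ y α₀ ^ 2 + 1 / 10000
      linarith
    · refine ENNReal.ofReal_le_ofReal (mul_le_mul_of_nonneg_left
        (Real.exp_le_exp.2 (neg_le_neg ?_)) (by positivity))
      change √i / 1000 ≤ y α₀ / 10
      have : √(i : ℝ) ≤ 100 * y α₀ := Real.sqrt_le_iff.2 ⟨by positivity, by linarith⟩
      linarith
  calc ∫⁻ x, A.sup (fun α => f α x) ∂Measure.pi (fun _ : Fin n => gaussianReal 0 1)
      ≤ ∫⁻ x, ∑ i ∈ A.image idx, (A.filter fun α => idx α = i).sup (fun α => f α x)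
        ∂Measure.pi (fun _ : Fin n => gaussianReal 0 1) := by
        refine lintegral_mono fun x => Finset.sup_le fun α hα => ?_
        refine le_trans ?_ (Finset.single_le_sum
          (f := fun i => (A.filter fun α => idx α = i).sup (fun α => f α x))
          (fun _ _ => zero_le) (Finset.mem_image_of_mem idx hα))
        exact Finset.le_sup (f := fun α => f α x) (Finset.mem_filter.2 ⟨hα, rfl⟩)
    _ = ∑ i ∈ A.image idx, ∫⁻ x, (A.filter fun α => idx α = i).sup (fun α => f α x)
        ∂Measure.pi (fun _ : Fin n => gaussianReal 0 1) :=
        lintegral_finsetSum _ fun i _ => measurable_finset_sup _ hfm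
    _ ≤ ∑ i ∈ A.image idx, ENNReal.ofReal
          (blockConst M * D lam h αbar ^ (1 + r) * Real.exp (-(√i / 1000))) :=
        Finset.sum_le_sum hblock
    _ = ENNReal.ofReal (blockConst M * D lam h αbar ^ (1 + r) *
          ∑ i ∈ A.image idx, Real.exp (-(√i / 1000))) := by
        rw [← ENNReal.ofReal_sum_of_nonneg fun i _ => by positivity, Finset.mul_sum]
    _ ≤ _ := by
        refine ENNReal.ofReal_le_ofReal (mul_le_mul_of_nonneg_left ?_ (by positivity))
        exact summable_exp_neg_sqrt.sum_le_tsum _ fun i _ => (Real.exp_pos _).le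

/-! ### From finite sets to the whole family. -/

/-- Transfer of the bound from finite sets of parameters to the whole family. -/
theorem lintegral_iSup_le (hlam : ∀ k, 0 < lam k) (hh : IsOrderedSmoother αbar h)
    (hD0 : 0 < D lam h αbar) (hDle : ∀ α ∈ Ioc 0 αbar, D lam h αbar ≤ D lam h α)
    {r γ M : ℝ} (hr : 0 ≤ r) (hrγ : r < γ) (hγ : γ ≤ M)
    {Ω : Type*} [MeasurableSpace Ω] {P : Measure Ω} [IsProbabilityMeasure P]
    {ξ : Fin n → Ω → ℝ} (hξ : ∀ k, HasLaw (ξ k) (gaussianReal 0 1) P) (hind : iIndepFun ξ P) :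
    ∫⁻ ω, ⨆ α ∈ Ioc 0 αbar, ENNReal.ofReal ((max 0 (eta lam h α (fun k => ξ k ω)
        - (1 + γ) * Qcirc lam h αbar α)) ^ (1 + r)) ∂P ≤
      ENNReal.ofReal (blockConst M * D lam h αbar ^ (1 + r) *
        ∑' i : ℕ, Real.exp (-(√i / 1000))) := by
  have hmap : P.map (fun ω k => ξ k ω) = Measure.pi fun _ : Fin n => gaussianReal 0 1 := by
    rw [(iIndepFun_iff_map_fun_eq_pi_map fun k => (hξ k).aemeasurable).1 hind]
    congr 1
    ext1 k
    exact (hξ k).map_eq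
  obtain ⟨T, hTS, hTc, hT⟩ := exists_countable_biSup_eq (Ioc 0 αbar)
    (fun α => (weight lam h α, Qcirc lam h αbar α))
    (g := fun (e : (Fin n → ℝ) × ℝ) (x : Fin n → ℝ) => ENNReal.ofReal
      ((max 0 (∑ k, e.1 k * (x k ^ 2 - 1) - (1 + γ) * e.2)) ^ (1 + r)))
    (fun x => ENNReal.continuous_ofReal.comp
      (Continuous.rpow_const (by fun_prop) fun _ => Or.inr (by linarith)))
  set f := fun α (x : Fin n → ℝ) => ENNReal.ofReal
    ((max 0 (eta lam h α x - (1 + γ) * Qcirc lam h αbar α)) ^ (1 + r)) with hf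
  have hfm : ∀ α, Measurable (f α) := fun α => by
    have := measurable_eta (lam := lam) (h := h) α
    fun_prop
  have hT' : ∀ x, ⨆ α ∈ Ioc 0 αbar, f α x = ⨆ α ∈ T, f α x := hT
  change ∫⁻ ω, ⨆ α ∈ Ioc 0 αbar, f α (fun k => ξ k ω) ∂P ≤ _
  simp_rw [hT']
  rw [← lintegral_map' (f := fun x => ⨆ α ∈ T, f α x)
    (Measurable.biSup T hTc fun α _ => hfm α).aemeasurable
    (aemeasurable_pi_lambda _ fun k => (hξ k).aemeasurable), hmap]
  exact lintegral_biSup_le_of_finset hTc hfm fun A hA =>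
    lintegral_sup_finset_le hlam hh hD0 hDle hr hrγ hγ fun α hα => hTS (hA hα)

end SpectralReg

theorem theorem1 (M : ℝ) :
    ∃ C : ℝ, 0 < C ∧
      ∀ (Ω : Type*) [MeasurableSpace Ω] (P : Measure Ω) [IsProbabilityMeasure P]
        (n : ℕ) (lam : Fin n → ℝ) (αbar : ℝ) (h : ℝ → Fin n → ℝ) (ξ : Fin n → Ω → ℝ),
        (∀ k, 0 < lam k) → Antitone lam →
        0 < αbar → SpectralReg.IsOrderedSmoother αbar h →
        0 < SpectralReg.D lam h αbar →
        (∀ α ∈ Set.Ioc 0 αbar, SpectralReg.D lam h αbar ≤ SpectralReg.D lam h α) →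
        (∀ k, HasLaw (ξ k) (gaussianReal 0 1) P) → iIndepFun ξ P →
        ∀ r γ : ℝ, 0 ≤ r → r < γ → γ ≤ M →
          ∫⁻ ω, ⨆ α ∈ Set.Ioc 0 αbar,
              ENNReal.ofReal
                ((max 0 (SpectralReg.eta lam h α (fun k => ξ k ω)
                  - (1 + γ) * SpectralReg.Qcirc lam h αbar α)) ^ (1 + r)) ∂P
            ≤ ENNReal.ofReal (C * SpectralReg.D lam h αbar ^ (1 + r) / (γ - r) ^ 3) := by
  have hS : 0 ≤ ∑' i : ℕ, Real.exp (-(√i / 1000)) := tsum_nonneg fun _ => (Real.exp_pos _).le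
  set S := ∑' i : ℕ, Real.exp (-(√i / 1000))
  have hK := SpectralReg.blockConst_pos (abs_nonneg M)
  -- The factor `(|M| + 1)³` dominates `(γ - r)³`. The absolute value keeps the constant positive
  -- for negative `M`, where no admissible `r`, `γ` exist.
  refine ⟨SpectralReg.blockConst |M| * (S + 1) * (|M| + 1) ^ 3, by positivity, ?_⟩
  intro Ω _ P _ n lam αbar h ξ hlam _ _ hh hD0 hDle hξ hind r γ hr hrγ hγ
  refine (SpectralReg.lintegral_iSup_le hlam hh hD0 hDle hr hrγ (hγ.trans (le_abs_self M))
    hξ hind).trans (ENNReal.ofReal_le_ofReal ?_)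
  have hpos : 0 < γ - r := sub_pos.2 hrγ
  have hle : (γ - r) ^ 3 ≤ (|M| + 1) ^ 3 := by
    gcongr
    linarith [le_abs_self M]
  rw [le_div_iff₀ (by positivity)]
  calc SpectralReg.blockConst |M| * SpectralReg.D lam h αbar ^ (1 + r) * S * (γ - r) ^ 3
      ≤ SpectralReg.blockConst |M| * SpectralReg.D lam h αbar ^ (1 + r) * (S + 1) *
          (|M| + 1) ^ 3 := by
        gcongr
        linarith
    _ = _ := by ring
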